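/- Let $\mathfrak g$ be a finite-dimensional real semisimple Lie algebra which is compact (it carries a positive definite symmetric bilinear form for which every $\operatorname{ad}_X$ is skew-symmetric), with Killing form $\kappa$. Let $\operatorname{Int}(\mathfrak g)\subset GL(\mathfrak g)$ be the adjoint group, generated by all $e^{\operatorname{ad}_X}$, let $S\subset\mathfrak g$ be a regular adjoint orbit, i.e. the $\operatorname{Int}(\mathfrak g)$-orbit of a regular element, and let $T_LS$ denote its tangent space at $L\in S$ (the velocities at $t=0$ of the curves $e(t)L$ with $e$ a smooth curve in $\operatorname{Int}(\mathfrak g)$ and $e(0)=1$). Equip $\mathfrak g$ with the constant metric $\kappa$ and the linear Poisson structure $$\{F,G\}(L)=\Pi_L(dF(L),dG(L))=\kappa(L,[\nabla F(L),\nabla G(L)]),$$ where $\nabla$ is the gradient with respect to $\kappa$, and let $\sharp_{\Pi}$ be given by $\beta(\sharp_\Pi\alpha)=\Pi(\alpha,\beta)$. Then: 1. The metric $g^S_{\rm ind}$ induced on $S$ by $\kappa$ is non-degenerate at every point of $S$ ($S$ is a good leaf). 2. There is exactly one field $\omega^S$ of bilinear forms on the tangent spaces of $S$ such that, for all $L\in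 S$ and $\alpha\in\mathfrak g^*$, the vector $\sharp_\Pi\alpha$ at $L$ lies in $T_LS$ and $i_{\sharp_\Pi\alpha}\omega^S=\alpha|_{T_LS}$ (the induced symplectic form). 3. There is exactly one field $\nu^S$ of bilinear forms on the tangent spaces of $S$ such that, for all $L\in S$ and $X,Y\in\mathfrak g$, the vectors $[L,X],[L,Y]$ lie in $T_LS$ and $$\nu^S([L,X],[L,Y])=-\kappa(X_1,Y_1),$$ where $X_1,Y_1$ are the components of $X,Y$ in $\operatorname{Im}(\operatorname{ad}_L)$ for the $\kappa$-orthogonal decomposition $\mathfrak g=\operatorname{Im}(\operatorname{ad}_L)\oplus\operatorname{Ker}(\operatorname{ad}_L)$ (the normal metric). 4. The double bracket metric $$\tau^S_{DB}(X,Y):=(g^S_{\rm ind})^{-1}\left(i_X\omega^S,i_Y\omega^S\right),\qquad X,Y\in T_LS,\ L\in S,$$ where $(g^S_{\rm ind})^{-1}$ is the co-metric of $g^S_{\rm ind}$, satisfies $$\tau^S_{DB}=-\nu^S .$$ -/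

import Mathlib

noncomputable section

namespace DoubleBracket

section LieGroupSide

variable (𝔤 : Type*) [LieRing 𝔤] [LieAlgebra ℝ 𝔤]

/-- A real Lie algebra is compact if it carries a positive definite symmetric bilinear form
for which every `ad x` is skew-symmetric. -/
def IsCompactLieAlgebra : Prop :=
  ∃ B : LinearMap.BilinForm ℝ 𝔤,
    (∀ x y, B x y = B y x) ∧ (∀ x, x ≠ 0 → 0 < B x x) ∧
      ∀ x y z : 𝔤, B ⁅x, y⁆ z = -B y ⁅x, z⁆

variable [FiniteDimensional ℝ 𝔤]

/-- The exponential of an endomorphism of a finite-dimensional real vector space, computed as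
the exponential of its matrix in a basis (it does not depend on the basis). -/
def linExp {V : Type*} [AddCommGroup V] [Module ℝ V] [FiniteDimensional ℝ V]
    (D : Module.End ℝ V) : Module.End ℝ V :=
  Matrix.toLin (Module.finBasis ℝ V) (Module.finBasis ℝ V)
    (NormedSpace.exp (LinearMap.toMatrix (Module.finBasis ℝ V) (Module.finBasis ℝ V) D))

/-- The adjoint group `Int 𝔤`: the subgroup of `GL(𝔤)` generated by all `exp (ad X)`. -/
def adjointGroup : Subgroup (𝔤 ≃ₗ[ℝ] 𝔤) :=
  Subgroup.closure {e | ∃ X : 𝔤, (e : 𝔤 →ₗ[ℝ] 𝔤) = linExp (LieAlgebra.ad ℝ 𝔤 X)}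

variable {𝔤}

/-- The adjoint orbit of `L`. -/
def adjointOrbit (L : 𝔤) : Set 𝔤 := {Y | ∃ e ∈ adjointGroup 𝔤, Y = e L}

/-- A regular adjoint orbit is the adjoint orbit of a regular element. -/
def IsRegularAdjointOrbit (S : Set 𝔤) : Prop :=
  ∃ L : 𝔤, LieAlgebra.IsRegular ℝ L ∧ S = adjointOrbit L

/-- `v` is a tangent vector at `L` of the adjoint orbit through `L`: it is the velocity at time
`0` of a curve `t ↦ e(t) L`, where `e` is a smooth curve in the adjoint group with `e(0) = 1`.
Smoothness and derivatives are tested on all linear functionals, which in finite dimension is the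
usual notion. -/
def IsTangentVector (L v : 𝔤) : Prop :=
  ∃ e : ℝ → (𝔤 ≃ₗ[ℝ] 𝔤),
    (∀ t, e t ∈ adjointGroup 𝔤) ∧ e 0 = 1 ∧
    (∀ (X : 𝔤) (φ : Module.Dual ℝ 𝔤), ContDiff ℝ (⊤ : ℕ∞) fun t => φ (e t X)) ∧
    ∀ φ : Module.Dual ℝ 𝔤, HasDerivAt (fun t => φ (e t L)) (φ v) 0

/-- The tangent space `T_L S` at `L` of the adjoint orbit `S` through `L`, that is the image of
the differential at `1` of the orbit map `e ↦ e L`. (The tangent vectors already form a linear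
subspace, the span only records this.) -/
def orbitTangentSpace (L : 𝔤) : Submodule ℝ 𝔤 :=
  Submodule.span ℝ {v | IsTangentVector L v}

/-- A field of bilinear forms on the tangent spaces of `S`. -/
abbrev FormField (S : Set 𝔤) : Type _ :=
  (L : S) → LinearMap.BilinForm ℝ (orbitTangentSpace (L : 𝔤))

/-- The metric induced on `S` by the ambient (constant) metric on `𝔤` given by the Killing
form. -/
def inducedMetric (S : Set 𝔤) : FormField S := fun L =>
  (killingForm ℝ 𝔤).restrict (orbitTangentSpace (L : 𝔤))

/-- `S` is good if the induced metric is non-degenerate at each point. -/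
def IsGood (S : Set 𝔤) : Prop := ∀ L : S, (inducedMetric S L).Nondegenerate

end LieGroupSide

section LinearAlgebra

variable {V : Type*} [AddCommGroup V] [Module ℝ V] [FiniteDimensional ℝ V]

/-- The isomorphism `♯_g : V* → V`, the inverse of `♭_g : v ↦ g(v, ·)`. -/
def sharp (g : LinearMap.BilinForm ℝ V) (hg : g.Nondegenerate) : Module.Dual ℝ V →ₗ[ℝ] V :=
  (g.toDual hg).symm.toLinearMap

/-- The inverse (co-metric) `g⁻¹` of a non-degenerate form `g`, a bilinear form on `V*`. -/
def cometric (g : LinearMap.BilinForm ℝ V) (hg : g.Nondegenerate) :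
    LinearMap.BilinForm ℝ (Module.Dual ℝ V) :=
  g.compl₁₂ (sharp g hg) (sharp g hg)

end LinearAlgebra

section Metrics

variable {𝔤 : Type*} [LieRing 𝔤] [LieAlgebra ℝ 𝔤] [FiniteDimensional ℝ 𝔤]

/-- The double bracket metric `τ(X, Y) = (g_ind)⁻¹ (i_X ω, i_Y ω)` of a good `S` carrying the
field of two-forms `ω`. -/
def doubleBracketMetric (S : Set 𝔤) (hS : IsGood S) (ω : FormField S) : FormField S := fun L =>
  (cometric (inducedMetric S L) (hS L)).compl₁₂ (ω L) (ω L)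

/-- `X₁` is the component of `X` in `Im (ad L)` for the decomposition
`𝔤 = Im (ad L) ⊕ Ker (ad L)`. -/
def IsImageComponent (L X X₁ : 𝔤) : Prop :=
  X₁ ∈ LinearMap.range (LieAlgebra.ad ℝ 𝔤 L) ∧ X - X₁ ∈ LinearMap.ker (LieAlgebra.ad ℝ 𝔤 L)

/-- `ν` is the normal metric of `S`: at each `L ∈ S` the vectors `[L, X]` are tangent to `S`, and
`ν([L, X], [L, Y]) = -κ(X₁, Y₁)`, where `X₁`, `Y₁` are the components of `X`, `Y` in
`Im (ad L)`. -/
def IsNormalMetric (S : Set 𝔤) (ν : FormField S) : Prop :=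
  ∀ (L : S) (X Y X₁ Y₁ : 𝔤),
    IsImageComponent (L : 𝔤) X X₁ → IsImageComponent (L : 𝔤) Y Y₁ →
    ∃ (hX : ⁅(L : 𝔤), X⁆ ∈ orbitTangentSpace (L : 𝔤))
      (hY : ⁅(L : 𝔤), Y⁆ ∈ orbitTangentSpace (L : 𝔤)),
      ν L ⟨_, hX⟩ ⟨_, hY⟩ = -killingForm ℝ 𝔤 X₁ Y₁

variable [LieAlgebra.IsKilling ℝ 𝔤]

/-- The covector `α = dF(L)` turned into the gradient `∇F(L)` with respect to the Killing form. -/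
def killingGradient : Module.Dual ℝ 𝔤 →ₗ[ℝ] 𝔤 :=
  sharp (killingForm ℝ 𝔤) (LieAlgebra.IsKilling.killingForm_nondegenerate ℝ 𝔤)

/-- The Poisson bivector at `L` of the linear Poisson bracket
`{F, G}(L) = κ(L, [∇F(L), ∇G(L)])` on `𝔤`, a bilinear form on covectors:
`Π_L(dF(L), dG(L)) = {F, G}(L)`. -/
def poissonBivector (L : 𝔤) : LinearMap.BilinForm ℝ (Module.Dual ℝ 𝔤) :=
  ((LieModule.toEnd ℝ 𝔤 𝔤 : 𝔤 →ₗ[ℝ] Module.End ℝ 𝔤).compr₂ (killingForm ℝ 𝔤 L)).compl₁₂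
    killingGradient killingGradient

/-- The map `♯_Π : T_L^* 𝔤 → T_L 𝔤` with `β(♯_Π α) = Π(α, β)`; the Hamiltonian vector field of
`G` is `X_G = ♯_Π (dG)`. -/
def poissonSharp (L : 𝔤) : Module.Dual ℝ 𝔤 →ₗ[ℝ] 𝔤 :=
  (Module.evalEquiv ℝ 𝔤).symm.toLinearMap ∘ₗ poissonBivector L

/-- `ω` is the symplectic form induced on `S` by the linear Poisson structure: at each `L ∈ S`
the Hamiltonian vectors `♯_Π α` are tangent to `S` and `i_{♯_Π α} ω` is the restriction of `α` to
the tangent space, i.e. `i_{X_G} ω = d(G|_S)`. -/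
def IsInducedSymplecticForm (S : Set 𝔤) (ω : FormField S) : Prop :=
  ∀ (L : S) (α : Module.Dual ℝ 𝔤),
    ∃ h : poissonSharp (L : 𝔤) α ∈ orbitTangentSpace (L : 𝔤),
      ∀ Y : orbitTangentSpace (L : 𝔤), ω L ⟨_, h⟩ Y = α (Y : 𝔤)

end Metrics

end DoubleBracket

end

namespace DoubleBracket

open LieAlgebra LieModule

/-! ### Exponentials of real matrices -/

section Exponential

attribute [local instance] Matrix.linftyOpNormedRing Matrix.linftyOpNormedAlgebra

variable {n : Type*} [Fintype n] [DecidableEq n]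

/-! Everything reduces to one operator on `T_L S`. Since `e^{ad X}` preserves the bracket and all
derivations are inner, `T_L S = Im (ad L)` (`orbitTangentSpace_eq_range`). Compactness gives `Im (ad
L) ∩ Ker (ad L) = 0`, so `ad L` restricts to an automorphism `A` of `T_L S` (`adTangentEquiv`), and
`κ` is non-degenerate there. Invariance of `κ` gives `♯_Π α = [L, ∇α]`. The defining conditions then
force `ω(u, v) = κ(A⁻¹u, v)` and `ν(u, v) = -κ(A⁻¹u, A⁻¹v)`. The co-metric turns `i_u ω` back into
`A⁻¹u`, hence `τ(u, v) = κ(A⁻¹u, A⁻¹v) = -ν(u, v)`. -/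

theorem matrix_hasDerivAt_exp_smul (M : Matrix n n ℝ) (t : ℝ) :
    HasDerivAt (fun u : ℝ => NormedSpace.exp (u • M)) (M * NormedSpace.exp (t • M)) t :=
  hasDerivAt_exp_smul_const' M t

theorem matrix_contDiff_exp_smul (M : Matrix n n ℝ) :
    ContDiff ℝ (⊤ : ℕ∞) fun u : ℝ => NormedSpace.exp (u • M) := by
  have h : ContDiff ℝ (⊤ : ℕ∞) (NormedSpace.exp : Matrix n n ℝ → Matrix n n ℝ) :=
    contDiff_iff_contDiffAt.2 fun x => (NormedSpace.exp_analytic (𝕂 := ℝ) x).contDiffAt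
  exact h.comp (contDiff_id.smul contDiff_const)

/-- If a linear map `A` from matrices to matrices turns left multiplication by `M` into the
commutator with `M`, then it turns left multiplication by `exp M` into the conjugation by it. -/
theorem matrix_exp_intertwine (M : Matrix n n ℝ) (A : Matrix n n ℝ →ₗ[ℝ] Matrix n n ℝ)
    (hA : ∀ N, A (M * N) = M * A N - A N * M) :
    A (NormedSpace.exp M) * NormedSpace.exp M = NormedSpace.exp M * A 1 := by
  have hE := matrix_hasDerivAt_exp_smul M
  have hE' : ∀ t : ℝ, HasDerivAt (fun u : ℝ => NormedSpace.exp (u • -M))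
      (NormedSpace.exp (t • -M) * -M) t := hasDerivAt_exp_smul_const (-M)
  have hAd : ∀ t : ℝ, HasDerivAt (fun u : ℝ => A (NormedSpace.exp (u • M)))
      (A (M * NormedSpace.exp (t • M))) t := fun t =>
    (LinearMap.toContinuousLinearMap A).hasFDerivAt.comp_hasDerivAt t (hE t)
  -- By `hA`, the terms in the derivative of `e^{-uM} A(e^{uM}) e^{uM}` cancel; the values at `u =
  -- 1` and `u = 0` are then compared.
  have hconst : ∀ t : ℝ, HasDerivAt (fun u : ℝ => NormedSpace.exp (u • -M) *
      A (NormedSpace.exp (u • M)) * NormedSpace.exp (u • M)) 0 t := fun t => by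
    have h := ((hE' t).mul (hAd t)).mul (hE t)
    rw [hA] at h
    refine h.congr_deriv ?_
    rw [Pi.mul_apply]
    noncomm_ring
  have h := is_const_of_deriv_eq_zero (fun t => (hconst t).differentiableAt)
    (fun t => (hconst t).deriv) 1 0
  simp only [one_smul, zero_smul, NormedSpace.exp_zero, one_mul, mul_one] at h
  have hinv : NormedSpace.exp M * NormedSpace.exp (-M) = 1 := by
    rw [← Matrix.exp_add_of_commute _ _ ((Commute.refl M).neg_right), add_neg_cancel,
      NormedSpace.exp_zero]
  rw [← h, ← mul_assoc, ← mul_assoc, hinv, one_mul]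

end Exponential

/-! ### One-parameter groups of endomorphisms -/

section LinExp

variable {V : Type*} [AddCommGroup V] [Module ℝ V] [FiniteDimensional ℝ V]

attribute [local instance] Matrix.linftyOpNormedRing Matrix.linftyOpNormedAlgebra

theorem linExp_zero : linExp (0 : Module.End ℝ V) = 1 := by
  simp [linExp, NormedSpace.exp_zero, Matrix.toLin_one, Module.End.one_eq_id]

theorem linExp_comp_neg (D : Module.End ℝ V) : linExp D ∘ₗ linExp (-D) = LinearMap.id := by
  have h := ((Commute.refl
    (LinearMap.toMatrix (Module.finBasis ℝ V) (Module.finBasis ℝ V) D)).neg_right)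
  rw [linExp, linExp, ← Matrix.toLin_mul, map_neg, ← Matrix.exp_add_of_commute _ _ h,
    add_neg_cancel, NormedSpace.exp_zero, Matrix.toLin_one]

/-- The exponential of an endomorphism as a linear automorphism. -/
noncomputable def linExpEquiv (D : Module.End ℝ V) : V ≃ₗ[ℝ] V :=
  LinearEquiv.ofLinearMap (linExp D) (linExp (-D)) (linExp_comp_neg D)
    (by simpa using linExp_comp_neg (-D))

/-- Evaluation of the endomorphism with a given matrix at `X`, followed by a functional. -/
noncomputable def matrixEval (X : V) (φ : Module.Dual ℝ V) :
    Matrix (Fin (Module.finrank ℝ V)) (Fin (Module.finrank ℝ V)) ℝ →ₗ[ℝ] ℝ :=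
  φ ∘ₗ LinearMap.applyₗ X ∘ₗ
    (Matrix.toLin (Module.finBasis ℝ V) (Module.finBasis ℝ V)).toLinearMap

theorem apply_linExp_smul (D : Module.End ℝ V) (X : V) (φ : Module.Dual ℝ V) (t : ℝ) :
    φ (linExp (t • D) X) = matrixEval X φ (NormedSpace.exp
      (t • LinearMap.toMatrix (Module.finBasis ℝ V) (Module.finBasis ℝ V) D)) := by
  simp [linExp, matrixEval]

theorem contDiff_linExp_smul (D : Module.End ℝ V) (X : V) (φ : Module.Dual ℝ V) :
    ContDiff ℝ (⊤ : ℕ∞) fun t : ℝ => φ (linExp (t • D) X) := by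
  simp only [apply_linExp_smul]
  exact (LinearMap.toContinuousLinearMap (matrixEval X φ)).contDiff.comp
    (matrix_contDiff_exp_smul _)

theorem hasDerivAt_linExp_smul (D : Module.End ℝ V) (X : V) (φ : Module.Dual ℝ V) :
    HasDerivAt (fun t : ℝ => φ (linExp (t • D) X)) (φ (D X)) 0 := by
  simp only [apply_linExp_smul]
  have h := (LinearMap.toContinuousLinearMap (matrixEval X φ)).hasFDerivAt.comp_hasDerivAt 0
    (matrix_hasDerivAt_exp_smul
      (LinearMap.toMatrix (Module.finBasis ℝ V) (Module.finBasis ℝ V) D) 0)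
  refine h.congr_deriv ?_
  rw [zero_smul, NormedSpace.exp_zero, mul_one]
  change φ (Matrix.toLin (Module.finBasis ℝ V) (Module.finBasis ℝ V)
    (LinearMap.toMatrix (Module.finBasis ℝ V) (Module.finBasis ℝ V) D) X) = _
  rw [Matrix.toLin_toMatrix]

end LinExp

/-! ### Tangent spaces of adjoint orbits -/

section Tangent

variable {𝔤 : Type*} [LieRing 𝔤] [LieAlgebra ℝ 𝔤] [FiniteDimensional ℝ 𝔤]

/-- Apply `matrix_exp_intertwine` to `A(N) = ad (N x)`, in matrix form: the Jacobi identity is its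
hypothesis, and evaluating its conclusion at `y` gives the claim. -/
theorem linExp_ad_lie (X x y : 𝔤) :
    linExp (ad ℝ 𝔤 X) ⁅x, y⁆ = ⁅linExp (ad ℝ 𝔤 X) x, linExp (ad ℝ 𝔤 X) y⁆ := by
  let b := Module.finBasis ℝ 𝔤
  let A : Matrix (Fin (Module.finrank ℝ 𝔤)) (Fin (Module.finrank ℝ 𝔤)) ℝ →ₗ[ℝ]
      Matrix (Fin (Module.finrank ℝ 𝔤)) (Fin (Module.finrank ℝ 𝔤)) ℝ :=
    (LinearMap.toMatrix b b).toLinearMap ∘ₗ (ad ℝ 𝔤 : 𝔤 →ₗ[ℝ] Module.End ℝ 𝔤) ∘ₗ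
      LinearMap.applyₗ x ∘ₗ (Matrix.toLin b b).toLinearMap
  have hA : ∀ N, A N = LinearMap.toMatrix b b (ad ℝ 𝔤 (Matrix.toLin b b N x)) := fun N => rfl
  have h := matrix_exp_intertwine (LinearMap.toMatrix b b (ad ℝ 𝔤 X)) A fun N => by
    rw [hA, hA, Matrix.toLin_mul b b b, Matrix.toLin_toMatrix, LinearMap.comp_apply, ad_apply,
      ← LinearMap.toMatrix_mul, ← LinearMap.toMatrix_mul, ← map_sub]
    congr 1
    ext z
    simp
  have h' := congrArg (fun N => Matrix.toLin b b N y) h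
  simp only [hA, Matrix.toLin_mul b b b, Matrix.toLin_toMatrix, Matrix.toLin_one,
    LinearMap.comp_apply, LinearMap.id_apply, ad_apply] at h'
  exact h'.symm

theorem adjointGroup_map_lie {e : 𝔤 ≃ₗ[ℝ] 𝔤} (he : e ∈ adjointGroup 𝔤) :
    ∀ x y : 𝔤, e ⁅x, y⁆ = ⁅e x, e y⁆ := by
  induction he using Subgroup.closure_induction with
  | mem e he =>
    obtain ⟨X, hX⟩ := he
    intro x y
    have h : ∀ z, e z = linExp (ad ℝ 𝔤 X) z := fun z => LinearMap.congr_fun hX z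
    rw [h, h, h, linExp_ad_lie]
  | one => exact fun _ _ => rfl
  | mul e f _ _ he hf =>
    intro x y
    rw [LinearEquiv.mul_apply, hf, he]
    rfl
  | inv e _ he =>
    intro x y
    apply e.injective
    have h : ∀ z, e (e⁻¹ z) = z := fun z => e.apply_symm_apply z
    rw [he, h, h, h]

theorem isTangentVector_lie (L X : 𝔤) : IsTangentVector L ⁅X, L⁆ := by
  refine ⟨fun t => linExpEquiv (t • ad ℝ 𝔤 X), fun t => Subgroup.subset_closure ⟨t • X, ?_⟩, ?_,
    fun Y φ => contDiff_linExp_smul _ Y φ, fun φ => hasDerivAt_linExp_smul _ L φ⟩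
  · rw [map_smul]
    rfl
  · ext z
    change linExp ((0 : ℝ) • ad ℝ 𝔤 X) z = z
    rw [zero_smul, linExp_zero]
    rfl

/-- In a basis, `φ` of a bracket is a finite sum of products of scalar functionals, so the scalar
product rule suffices. -/
theorem hasDerivAt_lie {f g : ℝ → 𝔤} {v w : 𝔤} {t : ℝ}
    (hf : ∀ φ : Module.Dual ℝ 𝔤, HasDerivAt (fun s => φ (f s)) (φ v) t)
    (hg : ∀ φ : Module.Dual ℝ 𝔤, HasDerivAt (fun s => φ (g s)) (φ w) t) (φ : Module.Dual ℝ 𝔤) :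
    HasDerivAt (fun s => φ ⁅f s, g s⁆) (φ (⁅v, g t⁆ + ⁅f t, w⁆)) t := by
  let b := Module.finBasis ℝ 𝔤
  have key : ∀ x y : 𝔤, φ ⁅x, y⁆ = ∑ i, b.coord i x * (φ ∘ₗ ad ℝ 𝔤 (b i)) y := fun x y => by
    conv_lhs => rw [← b.sum_repr x]
    simp [sum_lie, -Module.Basis.sum_repr]
  have h := HasDerivAt.fun_sum (u := Finset.univ) fun i _ =>
    (hf (b.coord i)).mul (hg (φ ∘ₗ ad ℝ 𝔤 (b i)))
  rw [map_add, key, key, ← Finset.sum_add_distrib]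
  simp only [key]
  exact h

theorem exists_derivative {V : Type*} [AddCommGroup V] [Module ℝ V] [FiniteDimensional ℝ V]
    {f : ℝ → V} {t : ℝ}
    (hf : ∀ φ : Module.Dual ℝ V, DifferentiableAt ℝ (fun s => φ (f s)) t) :
    ∃ v : V, ∀ φ : Module.Dual ℝ V, HasDerivAt (fun s => φ (f s)) (φ v) t := by
  let b := Module.finBasis ℝ V
  refine ⟨∑ i, deriv (fun s => b.coord i (f s)) t • b i, fun φ => ?_⟩
  have key : ∀ x : V, φ x = ∑ i, b.coord i x * φ (b i) := fun x => by
    conv_lhs => rw [← b.sum_repr x]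
    simp [-Module.Basis.sum_repr]
  have h := HasDerivAt.fun_sum (u := Finset.univ) fun i _ =>
    (hf (b.coord i)).hasDerivAt.mul_const (φ (b i))
  simp only [map_sum, map_smul, smul_eq_mul]
  simp only [key (f _)]
  exact h

theorem derivative_unique {V : Type*} [AddCommGroup V] [Module ℝ V] {f : ℝ → V} {t : ℝ} {v w : V}
    (hv : ∀ φ : Module.Dual ℝ V, HasDerivAt (fun s => φ (f s)) (φ v) t)
    (hw : ∀ φ : Module.Dual ℝ V, HasDerivAt (fun s => φ (f s)) (φ w) t) : v = w := by
  rw [← sub_eq_zero, ← Module.forall_dual_apply_eq_zero_iff ℝ]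
  intro φ
  rw [map_sub, (hv φ).unique (hw φ), sub_self]

/-- Differentiating `e(t)[X, Y] = [e(t)X, e(t)Y]` at `0` shows that `e'(0)` is a derivation. It is
inner because the Killing form is non-degenerate. -/
theorem IsTangentVector.exists_lie [IsKilling ℝ 𝔤] {L v : 𝔤} (h : IsTangentVector L v) :
    ∃ X : 𝔤, v = ⁅X, L⁆ := by
  obtain ⟨e, he, he0, hsmooth, hv⟩ := h
  choose D hD using fun X : 𝔤 => exists_derivative (t := 0) fun φ =>
    (hsmooth X φ).differentiable (by simp) 0
  have h0 : ∀ X, e 0 X = X := fun X => by rw [he0]; rfl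
  let δ : LieDerivation ℝ 𝔤 𝔤 :=
    { toFun := D
      map_add' := fun X Y => derivative_unique (hD (X + Y)) fun φ => by
        simpa using (hD X φ).fun_add (hD Y φ)
      map_smul' := fun c X => derivative_unique (hD (c • X)) fun φ => by
        simpa using (hD X φ).const_mul c
      leibniz' := fun X Y => derivative_unique (hD (⁅X, Y⁆ : 𝔤)) fun φ => by
        have h := hasDerivAt_lie (hD X) (hD Y) φ
        simp only [← adjointGroup_map_lie (he _), h0] at h
        refine h.congr_deriv (congrArg φ ?_)
        change _ = ⁅X, D Y⁆ - ⁅Y, D X⁆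
        rw [← lie_skew Y (D X)]
        abel }
  obtain ⟨Z, hZ⟩ := LieDerivation.IsKilling.exists_eq_ad δ
  refine ⟨Z, ?_⟩
  rw [derivative_unique hv (hD L)]
  change δ L = _
  rw [← hZ, LieDerivation.ad_apply_apply]

theorem orbitTangentSpace_eq_range [IsKilling ℝ 𝔤] (L : 𝔤) :
    orbitTangentSpace L = LinearMap.range (ad ℝ 𝔤 L) := by
  apply le_antisymm
  · refine Submodule.span_le.2 fun v hv => ?_
    obtain ⟨X, rfl⟩ := IsTangentVector.exists_lie hv
    exact ⟨-X, by simp⟩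
  · rintro _ ⟨X, rfl⟩
    refine Submodule.subset_span ?_
    have h := isTangentVector_lie L (-X)
    rwa [neg_lie, lie_skew] at h

end Tangent

/-! ### The action of `ad L` on the tangent space, and the Poisson tensor -/

section Decomposition

variable {𝔤 : Type*} [LieRing 𝔤] [LieAlgebra ℝ 𝔤]

/-- Skewness gives `B([L, X], [L, X]) = -B(X, [L, [L, X]])`, and `B` is definite. -/
theorem IsCompactLieAlgebra.lie_eq_zero_of_lie_lie_eq_zero (h : IsCompactLieAlgebra 𝔤) {L X : 𝔤}
    (hX : ⁅L, ⁅L, X⁆⁆ = 0) : ⁅L, X⁆ = 0 := by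
  obtain ⟨B, -, hpos, hskew⟩ := h
  by_contra hne
  have h1 := hpos _ hne
  rw [hskew, hX, map_zero, neg_zero] at h1
  exact lt_irrefl _ h1

theorem killingForm_lie (L X Y : 𝔤) : killingForm ℝ 𝔤 ⁅L, X⁆ Y = -killingForm ℝ 𝔤 X ⁅L, Y⁆ :=
  traceForm_apply_lie_apply' ℝ 𝔤 𝔤 L X Y

theorem IsImageComponent.lie_eq {L X X₁ : 𝔤} (h : IsImageComponent L X X₁) :
    ⁅L, X₁⁆ = ⁅L, X⁆ := by
  have h2 : ⁅L, X - X₁⁆ = 0 := h.2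
  rw [lie_sub, sub_eq_zero] at h2
  exact h2.symm

theorem eq_zero_of_killingForm_eq_zero [IsKilling ℝ 𝔤] {X : 𝔤}
    (h : ∀ Y, killingForm ℝ 𝔤 X Y = 0) : X = 0 :=
  (IsKilling.killingForm_nondegenerate ℝ 𝔤).1 X h

variable [FiniteDimensional ℝ 𝔤] [IsKilling ℝ 𝔤]

theorem lie_mem_orbitTangentSpace (L X : 𝔤) : ⁅L, X⁆ ∈ orbitTangentSpace L := by
  rw [orbitTangentSpace_eq_range]
  exact ⟨X, rfl⟩

theorem exists_lie_of_mem_orbitTangentSpace {L v : 𝔤} (hv : v ∈ orbitTangentSpace L) :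
    ∃ X, ⁅L, X⁆ = v := by
  rwa [orbitTangentSpace_eq_range] at hv

/-- If `[L, X]` is `κ`-orthogonal to every `[L, Y]`, invariance puts `[L, [L, X]]` in the radical of
`κ`, so it vanishes and compactness applies. -/
theorem isGood_of_isCompact (h𝔤 : IsCompactLieAlgebra 𝔤) (S : Set 𝔤) : IsGood S := by
  intro L
  have hsymm : (inducedMetric S L).IsSymm :=
    ⟨fun x y => traceForm_comm ℝ 𝔤 𝔤 (x : 𝔤) (y : 𝔤)⟩
  refine (LinearMap.IsRefl.nondegenerate_iff_separatingLeft hsymm.isRefl).2 ?_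
  rintro ⟨v, hv⟩ h
  obtain ⟨X, rfl⟩ := exists_lie_of_mem_orbitTangentSpace hv
  refine Subtype.ext (h𝔤.lie_eq_zero_of_lie_lie_eq_zero
    (eq_zero_of_killingForm_eq_zero fun Y => ?_))
  rw [killingForm_lie, neg_eq_zero]
  exact h ⟨_, lie_mem_orbitTangentSpace _ Y⟩

/-- The restriction of `ad L` to the tangent space of the orbit at `L`. -/
noncomputable def adTangent (L : 𝔤) : Module.End ℝ (orbitTangentSpace L) :=
  (ad ℝ 𝔤 L).restrict fun X _ => lie_mem_orbitTangentSpace L X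

theorem adTangent_injective (h𝔤 : IsCompactLieAlgebra 𝔤) (L : 𝔤) :
    Function.Injective (adTangent L) := by
  rw [injective_iff_map_eq_zero]
  rintro ⟨v, hv⟩ h
  obtain ⟨X, rfl⟩ := exists_lie_of_mem_orbitTangentSpace hv
  exact Subtype.ext (h𝔤.lie_eq_zero_of_lie_lie_eq_zero (congrArg Subtype.val h))

/-- The restriction of `ad L` to the tangent space of the orbit of a compact Lie algebra,
an automorphism. -/
noncomputable def adTangentEquiv (h𝔤 : IsCompactLieAlgebra 𝔤) (L : 𝔤) :
    orbitTangentSpace L ≃ₗ[ℝ] orbitTangentSpace L :=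
  LinearEquiv.ofInjectiveEndo (adTangent L) (adTangent_injective h𝔤 L)

theorem lie_adTangentEquiv_symm (h𝔤 : IsCompactLieAlgebra 𝔤) (L : 𝔤) (v : orbitTangentSpace L) :
    ⁅L, ((adTangentEquiv h𝔤 L).symm v : 𝔤)⁆ = v :=
  congrArg Subtype.val ((adTangentEquiv h𝔤 L).apply_symm_apply v)

theorem adTangentEquiv_symm_lie (h𝔤 : IsCompactLieAlgebra 𝔤) {L X₁ : 𝔤}
    (hX₁ : X₁ ∈ orbitTangentSpace L) {v : orbitTangentSpace L} (hv : ⁅L, X₁⁆ = v) :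
    (adTangentEquiv h𝔤 L).symm v = ⟨X₁, hX₁⟩ := by
  rw [LinearEquiv.symm_apply_eq]
  exact Subtype.ext hv.symm

/-- `X` and `A⁻¹[L, X]` differ by an element of `Ker (ad L)`, which is `κ`-orthogonal to `Im (ad
L)`. -/
theorem killingForm_adTangentEquiv_symm (h𝔤 : IsCompactLieAlgebra 𝔤) (L X : 𝔤)
    (hX : ⁅L, X⁆ ∈ orbitTangentSpace L) (v : orbitTangentSpace L) :
    killingForm ℝ 𝔤 ((adTangentEquiv h𝔤 L).symm ⟨_, hX⟩ : 𝔤) v = killingForm ℝ 𝔤 X v := by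
  rw [← lie_adTangentEquiv_symm h𝔤 L v, ← neg_inj, ← killingForm_lie, ← killingForm_lie,
    lie_adTangentEquiv_symm]

theorem IsImageComponent.mem_orbitTangentSpace {L X X₁ : 𝔤} (h : IsImageComponent L X X₁) :
    X₁ ∈ orbitTangentSpace L := by
  rw [orbitTangentSpace_eq_range]
  exact h.1

theorem isImageComponent_self {L X : 𝔤} (h : X ∈ orbitTangentSpace L) : IsImageComponent L X X := by
  rw [orbitTangentSpace_eq_range] at h
  exact ⟨h, by simp⟩

theorem killingForm_killingGradient (α : Module.Dual ℝ 𝔤) (X : 𝔤) :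
    killingForm ℝ 𝔤 (killingGradient α) X = α X :=
  LinearMap.BilinForm.apply_toDual_symm_apply α X

theorem killingGradient_killingForm (X : 𝔤) : killingGradient (killingForm ℝ 𝔤 X) = X :=
  (LinearMap.BilinForm.toDual _ (IsKilling.killingForm_nondegenerate ℝ 𝔤)).symm_apply_apply X

/-- By invariance, `κ(L, [∇α, ∇β]) = κ([L, ∇α], ∇β) = β([L, ∇α])`. -/
theorem poissonSharp_eq_lie (L : 𝔤) (α : Module.Dual ℝ 𝔤) :
    poissonSharp L α = ⁅L, killingGradient α⁆ := by
  rw [poissonSharp, LinearMap.comp_apply, LinearEquiv.coe_coe, LinearEquiv.symm_apply_eq]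
  ext β
  change killingForm ℝ 𝔤 L ⁅killingGradient α, killingGradient β⁆ = β ⁅L, killingGradient α⁆
  rw [← killingForm_killingGradient β, ← traceForm_apply_lie_apply, traceForm_comm]

end Decomposition

/-! ### The symplectic form, the normal metric and the double bracket metric -/

section Forms

variable {𝔤 : Type*} [LieRing 𝔤] [LieAlgebra ℝ 𝔤] [FiniteDimensional ℝ 𝔤] [IsKilling ℝ 𝔤]

/-- The field `ω(u, v) = κ((ad L)⁻¹ u, v)` of bilinear forms on an orbit. -/
noncomputable def orbitSymplecticForm (h𝔤 : IsCompactLieAlgebra 𝔤) (S : Set 𝔤) : FormField S := fun L =>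
  inducedMetric S L ∘ₗ (adTangentEquiv h𝔤 (L : 𝔤)).symm.toLinearMap

/-- The field `ν(u, v) = -κ((ad L)⁻¹ u, (ad L)⁻¹ v)` of bilinear forms on an orbit. -/
noncomputable def orbitNormalMetric (h𝔤 : IsCompactLieAlgebra 𝔤) (S : Set 𝔤) : FormField S := fun L =>
  -(inducedMetric S L).compl₁₂ (adTangentEquiv h𝔤 (L : 𝔤)).symm.toLinearMap
    (adTangentEquiv h𝔤 (L : 𝔤)).symm.toLinearMap

theorem isInducedSymplecticForm_orbitSymplecticForm (h𝔤 : IsCompactLieAlgebra 𝔤) (S : Set 𝔤) :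
    IsInducedSymplecticForm S (orbitSymplecticForm h𝔤 S) := by
  intro L α
  rw [poissonSharp_eq_lie]
  refine ⟨lie_mem_orbitTangentSpace _ _, fun Y => ?_⟩
  rw [← killingForm_killingGradient α]
  exact killingForm_adTangentEquiv_symm h𝔤 _ _ _ Y

theorem IsInducedSymplecticForm.eq_orbitSymplecticForm (h𝔤 : IsCompactLieAlgebra 𝔤) {S : Set 𝔤}
    {ω : FormField S} (hω : IsInducedSymplecticForm S ω) : ω = orbitSymplecticForm h𝔤 S := by
  funext L
  ext ⟨u, hu⟩ v
  obtain ⟨X, rfl⟩ := exists_lie_of_mem_orbitTangentSpace hu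
  -- The tangent vector `[L, X]` is `♯_Π` of the covector `κ(X, ·)`, so the defining condition fixes
  -- `ω` on it.
  have h1 := hω L (killingForm ℝ 𝔤 X)
  have h2 := isInducedSymplecticForm_orbitSymplecticForm h𝔤 S L (killingForm ℝ 𝔤 X)
  simp only [poissonSharp_eq_lie, killingGradient_killingForm] at h1 h2
  exact (h1.2 v).trans (h2.2 v).symm

theorem isNormalMetric_orbitNormalMetric (h𝔤 : IsCompactLieAlgebra 𝔤) (S : Set 𝔤) :
    IsNormalMetric S (orbitNormalMetric h𝔤 S) := by
  intro L X Y X₁ Y₁ hX hY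
  refine ⟨lie_mem_orbitTangentSpace _ _, lie_mem_orbitTangentSpace _ _, ?_⟩
  change -(inducedMetric S L) ((adTangentEquiv h𝔤 (L : 𝔤)).symm _)
    ((adTangentEquiv h𝔤 (L : 𝔤)).symm _) = _
  rw [adTangentEquiv_symm_lie h𝔤 hX.mem_orbitTangentSpace hX.lie_eq,
    adTangentEquiv_symm_lie h𝔤 hY.mem_orbitTangentSpace hY.lie_eq]
  rfl

theorem IsNormalMetric.eq_orbitNormalMetric (h𝔤 : IsCompactLieAlgebra 𝔤) {S : Set 𝔤}
    {ν : FormField S} (hν : IsNormalMetric S ν) : ν = orbitNormalMetric h𝔤 S := by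
  funext L
  ext u v
  -- The preimages `A⁻¹u` and `A⁻¹v` lie in `Im (ad L)`, so they are their own image components.
  have hu := isImageComponent_self ((adTangentEquiv h𝔤 (L : 𝔤)).symm u).2
  have hv := isImageComponent_self ((adTangentEquiv h𝔤 (L : 𝔤)).symm v).2
  have h1 := hν L _ _ _ _ hu hv
  simp only [lie_adTangentEquiv_symm] at h1
  exact h1.2.2

theorem doubleBracketMetric_orbitSymplecticForm (h𝔤 : IsCompactLieAlgebra 𝔤) (S : Set 𝔤)
    (hS : IsGood S) :
    doubleBracketMetric S hS (orbitSymplecticForm h𝔤 S) = -orbitNormalMetric h𝔤 S := by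
  funext L
  ext u v
  -- By construction `i_w ω` is `g(A⁻¹w, ·)`, with `g` the induced metric, so `♯_g` undoes `♭_g`.
  have h : ∀ w, sharp (inducedMetric S L) (hS L) (orbitSymplecticForm h𝔤 S L w) =
      (adTangentEquiv h𝔤 (L : 𝔤)).symm w := fun w =>
    ((inducedMetric S L).toDual (hS L)).symm_apply_apply _
  change inducedMetric S L (sharp _ _ _) (sharp _ _ _) = - -inducedMetric S L _ _
  rw [h, h, neg_neg]
  rfl

end Forms

end DoubleBracket

theorem mainTheorem2 {𝔤 : Type*} [LieRing 𝔤] [LieAlgebra ℝ 𝔤] [FiniteDimensional ℝ 𝔤]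
    [LieAlgebra.IsSemisimple ℝ 𝔤] (h𝔤 : DoubleBracket.IsCompactLieAlgebra 𝔤)
    (S : Set 𝔤) (hS : DoubleBracket.IsRegularAdjointOrbit S) :
    ∃ hgood : DoubleBracket.IsGood S,
      (∃! ω : DoubleBracket.FormField S, DoubleBracket.IsInducedSymplecticForm S ω) ∧
      (∃! ν : DoubleBracket.FormField S, DoubleBracket.IsNormalMetric S ν) ∧
      ∀ ω ν : DoubleBracket.FormField S,
        DoubleBracket.IsInducedSymplecticForm S ω → DoubleBracket.IsNormalMetric S ν →
          DoubleBracket.doubleBracketMetric S hgood ω = -ν := by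
  have hgood := DoubleBracket.isGood_of_isCompact h𝔤 S
  refine ⟨hgood, ⟨_, DoubleBracket.isInducedSymplecticForm_orbitSymplecticForm h𝔤 S,
    fun ω hω => hω.eq_orbitSymplecticForm h𝔤⟩, ⟨_,
    DoubleBracket.isNormalMetric_orbitNormalMetric h𝔤 S,
    fun ν hν => hν.eq_orbitNormalMetric h𝔤⟩, fun ω ν hω hν => ?_⟩
  rw [hω.eq_orbitSymplecticForm h𝔤, hν.eq_orbitNormalMetric h𝔤]
  exact DoubleBracket.doubleBracketMetric_orbitSymplecticForm h𝔤 S hgood
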